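/- All Banach spaces are real. For Banach spaces $X$ and $Y$, let $\mathrm{Lip}_0(X,Y)$ be the space of all Lipschitz maps $f\colon X\to Y$ with $f(0)=0$, endowed with the norm $$\|f\|=\sup\left\{\frac{\|f(x)-f(y)\|}{\|x-y\|} : x,y\in X,\ x\neq y\right\},$$ and let $D(X,Y)$ be the set of all $f\in \mathrm{Lip}_0(X,Y)$ which attain their norm through a derivative, that is, for which there are $x\in X$ and $e\in X$ with $\|e\|=1$ such that the limit $$f'(x,e)=\lim_{t\to 0}\frac{f(x+te)-f(x)}{t}\in Y$$ exists in norm and satisfies $\|f'(x,e)\|=\|f\|$. Let $Y$ be a Banach space. If $D(X,Y)$ is norm-dense in $\mathrm{Lip}_0(X,Y)$ for some nontrivial Banach space $X$ (i.e. $X\neq\{0\}$), then $Y$ has the Radon–Nikodým property: for every finite measure space $(\Omega,\Sigma,\mu)$ and every countably additive vector measure $G\colon\Sigma\to Y$ of bounded variation which is absolutely continuous with respect to $\mu$, there is a Bochner integrable function $g\colon\Omega\to Y$ such that $G(E)=\int_E g\,d\mu$ for all $E\in\Sigma$. -/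

import Mathlib

open MeasureTheory

universe u v w

/-- The real vector space of all Lipschitz maps `f : X → Y` with `f 0 = 0`, as a space of
functions (its norm is introduced below, on `Lip0`). -/
def lip0Submodule (X Y : Type*) [NormedAddCommGroup X] [NormedSpace ℝ X]
    [NormedAddCommGroup Y] [NormedSpace ℝ Y] : Submodule ℝ (X → Y) where
  carrier := {f | (∃ K : NNReal, LipschitzWith K f) ∧ f 0 = 0}
  zero_mem' := ⟨⟨0, LipschitzWith.const 0⟩, rfl⟩
  add_mem' := by
    rintro f g ⟨⟨K, hf⟩, hf0⟩ ⟨⟨L, hg⟩, hg0⟩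
    exact ⟨⟨K + L, hf.add hg⟩, by simp [hf0, hg0]⟩
  smul_mem' := by
    rintro c f ⟨⟨K, hf⟩, hf0⟩
    exact ⟨⟨‖c‖₊ * K, (lipschitzWith_smul c).comp hf⟩, by simp [hf0]⟩

/-- The space `Lip₀(X, Y)` of all Lipschitz maps `f : X → Y` with `f 0 = 0`. This is a type of its
own, so that it carries the topology of the Lipschitz norm and not that of pointwise
convergence. -/
def Lip0 (X Y : Type*) [NormedAddCommGroup X] [NormedSpace ℝ X]
    [NormedAddCommGroup Y] [NormedSpace ℝ Y] : Type _ :=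
  ↥(lip0Submodule X Y)

namespace Lip0

variable {X Y : Type*} [NormedAddCommGroup X] [NormedSpace ℝ X]
  [NormedAddCommGroup Y] [NormedSpace ℝ Y]

instance : AddCommGroup (Lip0 X Y) := inferInstanceAs (AddCommGroup ↥(lip0Submodule X Y))

instance : Module ℝ (Lip0 X Y) := inferInstanceAs (Module ℝ ↥(lip0Submodule X Y))

instance : CoeFun (Lip0 X Y) (fun _ => X → Y) := ⟨fun f => f.1⟩

/-- The Lipschitz norm: the supremum of `‖f x - f y‖ / ‖x - y‖` over all pairs `x ≠ y`. -/
noncomputable instance : Norm (Lip0 X Y) :=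
  ⟨fun f => ⨆ p : {p : X × X // p.1 ≠ p.2}, ‖f p.1.1 - f p.1.2‖ / ‖p.1.1 - p.1.2‖⟩

theorem norm_def (f : Lip0 X Y) :
    ‖f‖ = ⨆ p : {p : X × X // p.1 ≠ p.2}, ‖f p.1.1 - f p.1.2‖ / ‖p.1.1 - p.1.2‖ := rfl

theorem zero_apply (x : X) : (0 : Lip0 X Y) x = 0 := rfl

theorem add_apply (f g : Lip0 X Y) (x : X) : (f + g) x = f x + g x := rfl

theorem smul_apply (c : ℝ) (f : Lip0 X Y) (x : X) : (c • f) x = c • f x := rfl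

theorem map_zero (f : Lip0 X Y) : f 0 = 0 := f.2.2

theorem ext {f g : Lip0 X Y} (h : ∀ x, f x = g x) : f = g := Subtype.ext (funext h)

theorem bddAbove_slopes (f : Lip0 X Y) : BddAbove (Set.range
    fun p : {p : X × X // p.1 ≠ p.2} => ‖f p.1.1 - f p.1.2‖ / ‖p.1.1 - p.1.2‖) := by
  obtain ⟨⟨K, hK⟩, -⟩ := f.2
  refine ⟨K, ?_⟩
  rintro _ ⟨p, rfl⟩
  exact div_le_of_le_mul₀ (norm_nonneg _) K.2 (hK.norm_sub_le _ _)

theorem norm_sub_le (f : Lip0 X Y) (x y : X) : ‖f x - f y‖ ≤ ‖f‖ * ‖x - y‖ := by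
  rcases eq_or_ne x y with rfl | hxy
  · simp
  · rw [← div_le_iff₀ (norm_pos_iff.2 (sub_ne_zero.2 hxy))]
    exact le_ciSup (bddAbove_slopes f) ⟨(x, y), hxy⟩

theorem norm_nonneg' (f : Lip0 X Y) : 0 ≤ ‖f‖ := Real.iSup_nonneg fun _ => by positivity

theorem norm_le {f : Lip0 X Y} {C : ℝ} (hC : 0 ≤ C) (h : ∀ x y, ‖f x - f y‖ ≤ C * ‖x - y‖) :
    ‖f‖ ≤ C :=
  Real.iSup_le (fun _ => div_le_of_le_mul₀ (norm_nonneg _) hC (h _ _)) hC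

theorem core : NormedSpace.Core ℝ (Lip0 X Y) where
  norm_nonneg := norm_nonneg'
  norm_smul c f := by
    simp only [norm_def, smul_apply, ← smul_sub, norm_smul, mul_div_assoc]
    exact (Real.mul_iSup_of_nonneg (norm_nonneg c) _).symm
  norm_triangle f g := norm_le (add_nonneg (norm_nonneg' f) (norm_nonneg' g)) fun x y => by
    rw [add_apply, add_apply, add_sub_add_comm, add_mul]
    exact (norm_add_le _ _).trans (add_le_add (norm_sub_le f x y) (norm_sub_le g x y))
  norm_eq_zero_iff f := by
    constructor
    · intro h
      refine ext fun x => ?_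
      have := norm_sub_le f x 0
      rw [h, zero_mul, map_zero, sub_zero] at this
      exact norm_le_zero_iff.1 this
    · rintro rfl
      simp [norm_def, zero_apply]

noncomputable instance : NormedAddCommGroup (Lip0 X Y) := NormedAddCommGroup.ofCore core

noncomputable instance : NormedSpace ℝ (Lip0 X Y) := NormedSpace.ofCore core

end Lip0

/-- The set of all `f ∈ Lip₀(X, Y)` which attain their norm through a derivative: at some point
`x : X` and for some direction `e` in the unit sphere of `X`, the two-sided limit
`f'(x, e) = lim_{t → 0} (f (x + t e) - f x) / t` exists in `Y` (in the norm topology) and has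
norm `‖f‖`. -/
def derivAttaining (X Y : Type*) [NormedAddCommGroup X] [NormedSpace ℝ X]
    [NormedAddCommGroup Y] [NormedSpace ℝ Y] : Set (Lip0 X Y) :=
  {f | ∃ (x e : X) (y : Y), ‖e‖ = 1 ∧ HasLineDerivAt ℝ (f : X → Y) y x e ∧ ‖y‖ = ‖f‖}

/-- The Radon–Nikodým property of a real normed space `Y`, tested on measurable spaces in the
universe `w`: for every finite measure space `(Ω, μ)`, every countably additive vector measure
`G` with values in `Y` which has bounded variation and is absolutely continuous with respect to `μ`
is of the form `G s = ∫ x in s, g x ∂μ` for a Bochner integrable function `g : Ω → Y`. -/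
def HasRadonNikodymProperty (Y : Type v) [NormedAddCommGroup Y] [NormedSpace ℝ Y] : Prop :=
  ∀ (Ω : Type w) [MeasurableSpace Ω] (μ : Measure Ω) [IsFiniteMeasure μ] (G : VectorMeasure Ω Y),
    G.variation Set.univ < ⊤ →
    (∀ s : Set Ω, MeasurableSet s → μ s = 0 → G s = 0) →
    ∃ g : Ω → Y, Integrable g μ ∧ ∀ s : Set Ω, MeasurableSet s → G s = ∫ x in s, g x ∂μ

/-! A failure of the Radon–Nikodým property produces a 1-Lipschitz curve `F : ℝ → Y` without nonzero
approximate derivatives, and density of `derivAttaining X Y` rules such a curve out.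

Let `ν` be the variation of `G`. Suppose that inside some nonnull `A` the averages of `G` oscillate
by `ε` on every nonnull subset. Then each pair `(ν B, G B)` splits into finitely many such pairs,
each of slope at distance at least `ε` from the original one (`exists_isSplitting`). Iterating gives
polygonal paths, each refining the previous one; their vertices lie on the graph of a curve `F`
whose slopes over the cells shrinking to a point keep jumping by `ε`
(`IsSplitting.exists_lipschitzWith`). On the other hand, for a norming functional `φ`, the map `F ∘
φ` (normalized at `0`) is close in Lipschitz norm to one attaining its norm through a derivative,
and reading this along the direction of that derivative gives `F` an approximate derivative away
from zero (`exists_approx_deriv_of_dense`).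

Hence the averages of `G` are locally almost constant. By exhaustion, simple densities approximate
`G` in variation; their `L¹` limit is a density with respect to `ν`, and the chain rule passes to
`μ`. -/

/-- Dependent choice along an invariant. -/
theorem exists_seq_of_invariant {α : Type*} {P : ℕ → α → Prop} {R : α → α → Prop}
    (h0 : ∃ a, P 0 a) (hs : ∀ n a, P n a → ∃ b, P (n + 1) b ∧ R a b) :
    ∃ u : ℕ → α, ∀ n, P n (u n) ∧ R (u n) (u (n + 1)) := by
  choose! next hP hR using hs
  obtain ⟨a, ha⟩ := h0
  let u : ℕ → α := fun n => Nat.rec a (fun n b => next n b) n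
  have hu : ∀ n, P n (u n) := fun n => by
    induction n with
    | zero => exact ha
    | succ n ih => exact hP n _ ih
  exact ⟨u, fun n => ⟨hu n, hR n _ (hu n)⟩⟩

/-! ### Curves built by repeatedly splitting slopes -/

namespace SlopeSplitting

variable {Y : Type*} [NormedAddCommGroup Y] [NormedSpace ℝ Y]

/-- The successive subdivisions of a single vector. -/
def level (split : ℝ × Y → List (ℝ × Y)) (v : ℝ × Y) : ℕ → List (ℝ × Y)
  | 0 => [v]
  | n + 1 => (level split v n).flatMap split

/-- The vertices of all the polygonal paths `level split v n`, starting at the origin. -/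
def vertices (split : ℝ × Y → List (ℝ × Y)) (v : ℝ × Y) : Set (ℝ × Y) :=
  {a | ∃ n, ∃ p, p <+: level split v n ∧ p.sum = a}

/-- A set `G` of pairs (length, increment), of slopes at most one, each of which is subdivided by
`split` into members of `G` whose slopes differ by at least `ε` from its own. -/
structure IsSplitting (G : Set (ℝ × Y)) (split : ℝ × Y → List (ℝ × Y)) (ε : ℝ) : Prop where
  pos : ∀ v ∈ G, 0 < v.1
  norm_le : ∀ v ∈ G, ‖v.2‖ ≤ v.1
  sum_eq : ∀ v ∈ G, (split v).sum = v
  mem : ∀ v ∈ G, ∀ w ∈ split v, w ∈ G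
  gap : ∀ v ∈ G, ∀ w ∈ split v, ε * w.1 ≤ ‖w.2 - (w.1 / v.1) • v.2‖

omit [NormedSpace ℝ Y] in
theorem exists_append_of_le_sum (l : List (ℝ × Y)) (hl : l ≠ []) (c t : ℝ) (h1 : c ≤ t)
    (h2 : t ≤ c + l.sum.1) :
    ∃ p w r, l = p ++ w :: r ∧ c + (p.sum).1 ≤ t ∧ t ≤ c + (p.sum).1 + w.1 := by
  induction l generalizing c with
  | nil => exact absurd rfl hl
  | cons w r ih =>
    by_cases h : t ≤ c + w.1
    · exact ⟨[], w, r, by simp, by simpa using h1, by simpa using h⟩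
    · have hr : r ≠ [] := by
        rintro rfl
        simp at h2
        exact h h2
      obtain ⟨p, w', r', rfl, h3, h4⟩ := ih hr (c + w.1) (le_of_not_ge h)
        (by simpa [add_assoc] using h2)
      exact ⟨w :: p, w', r', by simp, by simpa [add_assoc] using h3,
        by simpa [add_assoc] using h4⟩

namespace IsSplitting

variable {G : Set (ℝ × Y)} {split : ℝ × Y → List (ℝ × Y)} {ε : ℝ} {v₀ : ℝ × Y}

theorem mem_of_mem_level (h : IsSplitting G split ε) (hv : v₀ ∈ G) (n : ℕ) :
    ∀ w ∈ level split v₀ n, w ∈ G := by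
  induction n with
  | zero => simpa [level] using hv
  | succ n ih =>
    intro w hw
    obtain ⟨v, hv, hw⟩ := List.mem_flatMap.1 hw
    exact h.mem v (ih v hv) w hw

theorem sum_flatMap (h : IsSplitting G split ε) (l : List (ℝ × Y)) (hl : ∀ w ∈ l, w ∈ G) :
    (l.flatMap split).sum = l.sum := by
  induction l with
  | nil => simp
  | cons w r ih =>
    rw [List.flatMap_cons, List.sum_append, List.sum_cons, h.sum_eq w (hl w (by simp)),
      ih fun x hx => hl x (by simp [hx])]

theorem norm_sum_le (h : IsSplitting G split ε) (l : List (ℝ × Y)) (hl : ∀ w ∈ l, w ∈ G) :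
    ‖l.sum.2‖ ≤ l.sum.1 := by
  induction l with
  | nil => simp
  | cons w r ih =>
    rw [List.sum_cons]
    exact (norm_add_le _ _).trans
      (add_le_add (h.norm_le w (hl w (by simp))) (ih fun x hx => hl x (by simp [hx])))

theorem sum_nonneg (h : IsSplitting G split ε) (l : List (ℝ × Y)) (hl : ∀ w ∈ l, w ∈ G) :
    0 ≤ l.sum.1 :=
  (norm_nonneg _).trans (h.norm_sum_le l hl)

theorem sum_level (h : IsSplitting G split ε) (hv : v₀ ∈ G) (n : ℕ) :
    (level split v₀ n).sum = v₀ := by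
  induction n with
  | zero => simp [level]
  | succ n ih => rw [level, h.sum_flatMap _ (h.mem_of_mem_level hv n), ih]

theorem fst_mem_Icc (h : IsSplitting G split ε) (hv : v₀ ∈ G) {a : ℝ × Y}
    (ha : a ∈ vertices split v₀) : a.1 ∈ Set.Icc 0 v₀.1 := by
  obtain ⟨n, p, ⟨r, hr⟩, rfl⟩ := ha
  have hmem : ∀ w ∈ p ++ r, w ∈ G := hr ▸ h.mem_of_mem_level hv n
  have hp := h.sum_nonneg p fun w hw => hmem w (by simp [hw])
  have hr0 := h.sum_nonneg r fun w hw => hmem w (by simp [hw])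
  have hs := h.sum_level hv n
  rw [← hr, List.sum_append] at hs
  rw [← hs]
  exact ⟨hp, by simpa using hr0⟩

/-- Splitting preserves sums, so a vertex of one path stays a vertex of all later ones. -/
theorem exists_prefix_level (h : IsSplitting G split ε) (hv : v₀ ∈ G) {n m : ℕ} (hnm : n ≤ m)
    {p : List (ℝ × Y)} (hp : p <+: level split v₀ n) :
    ∃ q, q <+: level split v₀ m ∧ q.sum = p.sum := by
  induction m, hnm using Nat.le_induction with
  | base => exact ⟨p, hp, rfl⟩
  | succ m _ ih =>
    obtain ⟨q, hq, hqs⟩ := ih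
    refine ⟨q.flatMap split, ?_, ?_⟩
    · obtain ⟨r, hr⟩ := hq
      exact ⟨r.flatMap split, by rw [← List.flatMap_append, hr, level]⟩
    · rw [h.sum_flatMap q fun w hw => h.mem_of_mem_level hv m w (hq.subset hw), hqs]

/-- On a common level one of the two prefixes extends the other, and what lies between them is a sum
of members of `G`, all of slope at most one. -/
theorem norm_sub_le_of_mem_vertices (h : IsSplitting G split ε) (hv : v₀ ∈ G) {a b : ℝ × Y}
    (ha : a ∈ vertices split v₀) (hb : b ∈ vertices split v₀) :
    ‖b.2 - a.2‖ ≤ |b.1 - a.1| := by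
  obtain ⟨n, p, hp, rfl⟩ := ha
  obtain ⟨m, q, hq, rfl⟩ := hb
  obtain ⟨p', hp', hps⟩ := h.exists_prefix_level hv (le_max_left n m) hp
  obtain ⟨q', hq', hqs⟩ := h.exists_prefix_level hv (le_max_right n m) hq
  rw [← hps, ← hqs]
  rcases List.prefix_or_prefix_of_prefix hp' hq' with ⟨r, rfl⟩ | ⟨r, rfl⟩
  · have := h.norm_sum_le r fun w hw => h.mem_of_mem_level hv _ w (hq'.subset (by simp [hw]))
    simpa using this.trans (le_abs_self _)
  · have := h.norm_sum_le r fun w hw => h.mem_of_mem_level hv _ w (hp'.subset (by simp [hw]))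
    simpa using this.trans (le_abs_self _)

/-- Equal first coordinates force equal second ones, so the closure is the graph of a 1-Lipschitz
function. -/
theorem norm_sub_le_of_mem_closure (h : IsSplitting G split ε) (hv : v₀ ∈ G) {a b : ℝ × Y}
    (ha : a ∈ closure (vertices split v₀)) (hb : b ∈ closure (vertices split v₀)) :
    ‖b.2 - a.2‖ ≤ |b.1 - a.1| := by
  have hcl : IsClosed {q : (ℝ × Y) × (ℝ × Y) | ‖q.2.2 - q.1.2‖ ≤ |q.2.1 - q.1.1|} :=
    isClosed_le (by fun_prop) (by fun_prop)
  have : (a, b) ∈ closure (vertices split v₀ ×ˢ vertices split v₀) := by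
    rw [closure_prod_eq]; exact ⟨ha, hb⟩
  exact closure_minimal (fun q hq => h.norm_sub_le_of_mem_vertices hv hq.1 hq.2) hcl this

/-- The cells from `c n` to `c n + v n` form a nested sequence around `t`, each one a piece of the
subdivision of its predecessor. -/
theorem exists_cells (h : IsSplitting G split ε) (hv : v₀ ∈ G) {t : ℝ} (ht : t ∈ Set.Icc 0 v₀.1) :
    ∃ c v : ℕ → ℝ × Y, ∀ n, c n ∈ vertices split v₀ ∧ c n + v n ∈ vertices split v₀ ∧ v n ∈ G ∧
      (c n).1 ≤ t ∧ t ≤ (c n).1 + (v n).1 ∧ (c n).1 ≤ (c (n + 1)).1 ∧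
      (c (n + 1)).1 + (v (n + 1)).1 ≤ (c n).1 + (v n).1 ∧
      ε * (v (n + 1)).1 ≤ ‖(v (n + 1)).2 - ((v (n + 1)).1 / (v n).1) • (v n).2‖ := by
  obtain ⟨u, hu⟩ := exists_seq_of_invariant
    (α := List (ℝ × Y) × (ℝ × Y))
    (P := fun n s => s.1 ++ [s.2] <+: level split v₀ n ∧ (s.1.sum).1 ≤ t ∧
      t ≤ (s.1.sum).1 + s.2.1)
    (R := fun s s' => (s.1.sum).1 ≤ (s'.1.sum).1 ∧
      (s'.1.sum).1 + s'.2.1 ≤ (s.1.sum).1 + s.2.1 ∧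
      ε * s'.2.1 ≤ ‖s'.2.2 - (s'.2.1 / s.2.1) • s.2.2‖)
    ⟨([], v₀), by simp [level], by simpa using ht.1, by simpa using ht.2⟩ (by
      rintro n ⟨q, v⟩ ⟨hq, h1, h2⟩
      dsimp only at hq h1 h2
      have hmem : ∀ w ∈ q ++ [v], w ∈ G := fun w hw => h.mem_of_mem_level hv n w (hq.subset hw)
      have hvG : v ∈ G := hmem v (by simp)
      have hqG : ∀ w ∈ q, w ∈ G := fun w hw => hmem w (by simp [hw])
      have hsum := h.sum_eq v hvG
      have hne : split v ≠ [] := by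
        intro h0
        rw [h0] at hsum
        have := h.pos v hvG
        rw [← hsum] at this
        simp at this
      obtain ⟨p, w, r, hl, h3, h4⟩ := exists_append_of_le_sum (split v) hne (q.sum).1 t h1
        (by rw [hsum]; exact h2)
      have hmem' : ∀ x ∈ p ++ w :: r, x ∈ G := fun x hx => h.mem v hvG x (hl ▸ hx)
      have hp0 := h.sum_nonneg p fun x hx => hmem' x (by simp [hx])
      have hr0 := h.sum_nonneg r fun x hx => hmem' x (by simp [hx])
      have hs1 : (v : ℝ × Y).1 = p.sum.1 + (w.1 + r.sum.1) := by
        conv_lhs => rw [← hsum, hl]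
        simp
      have hqs := h.sum_flatMap q hqG
      refine ⟨(q.flatMap split ++ p, w), ⟨?_, ?_, ?_⟩, ?_, ?_, ?_⟩
      · obtain ⟨r', hr'⟩ := hq
        refine ⟨r ++ r'.flatMap split, ?_⟩
        rw [level, ← hr']
        simp [hl]
      · simpa [hqs] using h3
      · simpa [hqs] using h4
      · simpa [hqs] using hp0
      · simp only [List.sum_append, hqs, Prod.fst_add]
        linarith
      · exact h.gap v hvG w (by rw [hl]; simp))
  refine ⟨fun n => (u n).1.sum, fun n => (u n).2, fun n => ?_⟩
  obtain ⟨⟨h1, h2, h3⟩, h4, h5, h6⟩ := hu n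
  exact ⟨⟨n, _, (List.prefix_append _ _).trans h1, rfl⟩, ⟨n, _, h1, by simp⟩,
    h.mem_of_mem_level hv n _ (h1.subset (by simp)), h2, h3, h4, h5, h6⟩

-- `IsSplitting` imposes no bound on the mesh; it is the gap between consecutive slopes that forces
-- the cells to shrink to `t`.
open Filter Topology in
theorem exists_cells_tendsto [CompleteSpace Y] (h : IsSplitting G split ε) (hε : 0 < ε)
    (hv : v₀ ∈ G) {t : ℝ} (ht : t ∈ Set.Icc 0 v₀.1) :
    ∃ (c v : ℕ → ℝ × Y) (y : Y), (∀ n, c n ∈ vertices split v₀ ∧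
      c n + v n ∈ vertices split v₀ ∧ v n ∈ G ∧ (c n).1 ≤ t ∧ t ≤ (c n).1 + (v n).1 ∧
      ε * (v (n + 1)).1 ≤ ‖(v (n + 1)).2 - ((v (n + 1)).1 / (v n).1) • (v n).2‖) ∧
      Tendsto (fun n => (v n).1) atTop (𝓝 0) ∧ Tendsto c atTop (𝓝 (t, y)) := by
  obtain ⟨c, v, hcv⟩ := h.exists_cells hv ht
  have hcau : ∀ {x : ℕ → ℝ × Y} {a : ℝ}, (∀ n, x n ∈ vertices split v₀) →
      Tendsto (fun n => (x n).1) atTop (𝓝 a) → ∃ y, Tendsto (fun n => (x n).2) atTop (𝓝 y) := by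
    intro x a hx hxa
    refine cauchySeq_tendsto_of_complete (Metric.cauchySeq_iff.2 fun δ hδ => ?_)
    obtain ⟨N, hN⟩ := Metric.cauchySeq_iff.1 hxa.cauchySeq δ hδ
    refine ⟨N, fun m hm n hn => lt_of_le_of_lt ?_ (hN m hm n hn)⟩
    rw [dist_eq_norm, Real.dist_eq]
    exact h.norm_sub_le_of_mem_vertices hv (hx n) (hx m)
  have hca := tendsto_atTop_ciSup (monotone_nat_of_le_succ fun n => (hcv n).2.2.2.2.2.1)
    ⟨t, by rintro _ ⟨n, rfl⟩; exact (hcv n).2.2.2.1⟩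
  have hcb := tendsto_atTop_ciInf (f := fun n => (c n + v n).1)
    (antitone_nat_of_succ_le fun n => (hcv n).2.2.2.2.2.2.1)
    ⟨t, by rintro _ ⟨n, rfl⟩; exact (hcv n).2.2.2.2.1⟩
  obtain ⟨y, hy⟩ := hcau (fun n => (hcv n).1) hca
  obtain ⟨z, hz⟩ := hcau (fun n => (hcv n).2.1) hcb
  set a := ⨆ n, (c n).1
  set b := ⨅ n, (c n + v n).1
  have hv1 : Tendsto (fun n => (v n).1) atTop (𝓝 (b - a)) := by
    simpa using hcb.sub hca
  have hv2 : Tendsto (fun n => (v n).2) atTop (𝓝 (z - y)) := by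
    simpa using hz.sub hy
  -- With a positive limit length the consecutive slopes would converge to one value, and the gap
  -- inequality would become `ε * (b - a) ≤ 0`.
  have hd0 : b - a = 0 := by
    by_contra hne
    have hpos : 0 < b - a := lt_of_le_of_ne
      (ge_of_tendsto' hv1 fun n => (h.pos _ (hcv n).2.2.1).le) (Ne.symm hne)
    have hv1' := (tendsto_add_atTop_iff_nat 1).2 hv1
    have hv2' := (tendsto_add_atTop_iff_nat 1).2 hv2
    have := le_of_tendsto_of_tendsto' (hv1'.const_mul ε)
      ((hv2'.sub ((hv1'.div hv1 hne).smul hv2)).norm) fun n => (hcv n).2.2.2.2.2.2.2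
    rw [div_self hne, one_smul, sub_self, norm_zero] at this
    exact absurd this (not_le.2 (mul_pos hε hpos))
  rw [hd0] at hv1
  have hat : a = t := le_antisymm (le_of_tendsto' hca fun n => (hcv n).2.2.2.1)
    (by
      have := ge_of_tendsto' hcb fun n => (hcv n).2.2.2.2.1
      linarith)
  refine ⟨c, v, y, fun n => ?_, hv1, ?_⟩
  · obtain ⟨h1, h2, h3, h4, h5, -, -, h6⟩ := hcv n
    exact ⟨h1, h2, h3, h4, h5, h6⟩
  · rw [← hat]
    exact hca.prodMk_nhds hy

open Filter Topology in
/-- A set of vectors with a splitting yields a Lipschitz curve which is not even approximately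
differentiable at any point, up to approximate derivatives which are close to zero. -/
theorem exists_lipschitzWith [CompleteSpace Y] (h : IsSplitting G split ε) (hε : 0 < ε)
    (hv : v₀ ∈ G) :
    ∃ F : ℝ → Y, LipschitzWith 1 F ∧ (∃ a b, a < b ∧ ε / 2 * (b - a) ≤ ‖F b - F a‖) ∧
      ∀ (t η : ℝ) (y : Y), η < ε / 2 → η < ‖y‖ →
        ¬ ∀ᶠ s in 𝓝 0, ‖F (t + s) - F t - s • y‖ ≤ η * |s| := by
  have hℓ : (0 : ℝ) ≤ v₀.1 := (h.pos _ hv).le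
  have hex : ∀ t ∈ Set.Icc 0 v₀.1, ∃ y, (t, y) ∈ closure (vertices split v₀) := by
    intro t ht
    obtain ⟨c, v, y, hcv, -, hc⟩ := h.exists_cells_tendsto hε hv ht
    exact ⟨y, mem_closure_of_tendsto hc (Eventually.of_forall fun n => (hcv n).1)⟩
  choose! f hf using hex
  have hfeq : ∀ a ∈ vertices split v₀, a.1 ∈ Set.Icc 0 v₀.1 → f a.1 = a.2 := by
    intro a ha ha1
    have := h.norm_sub_le_of_mem_closure hv (hf _ ha1) (subset_closure ha)
    simp only [sub_self, abs_zero, norm_le_zero_iff, sub_eq_zero] at this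
    exact this.symm
  have hbound := fun a ha => h.fst_mem_Icc hv (a := a) ha
  have hlip : ∀ s ∈ Set.Icc 0 v₀.1, ∀ t ∈ Set.Icc 0 v₀.1, ‖f s - f t‖ ≤ |s - t| := fun s hs t ht =>
    h.norm_sub_le_of_mem_closure hv (hf t ht) (hf s hs)
  -- The extension is constant outside `[0, v₀.1]`; this is why approximate derivatives near zero
  -- are excluded by `η < ‖y‖`.
  let F : ℝ → Y := fun t => f (Set.projIcc 0 v₀.1 hℓ t)
  have hFf : ∀ t ∈ Set.Icc 0 v₀.1, F t = f t := fun t ht => by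
    simp only [F, Set.projIcc_of_mem hℓ ht]
  have hFv : ∀ a ∈ vertices split v₀, F a.1 = a.2 := fun a ha => by
    rw [hFf _ (hbound a ha), hfeq a ha (hbound a ha)]
  have hconst : ∀ (t η : ℝ) (y : Y), η < ‖y‖ → (∀ᶠ s in 𝓝 t, F s = F t) →
      ¬ ∀ᶠ s in 𝓝 0, ‖F (t + s) - F t - s • y‖ ≤ η * |s| := by
    intro t η y hy hF hev
    have hF' : ∀ᶠ s in 𝓝 (0 : ℝ), F (t + s) = F t := by
      have : Tendsto (fun s : ℝ => t + s) (𝓝 0) (𝓝 t) := by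
        simpa using (continuous_const_add t).tendsto 0
      exact this.eventually hF
    obtain ⟨s, ⟨h1, h2⟩, hs⟩ := ((hev.and hF').filter_mono nhdsWithin_le_nhds |>.and
      (self_mem_nhdsWithin (a := (0 : ℝ)) (s := {0}ᶜ))).exists
    rw [h2, sub_self, zero_sub, norm_neg, norm_smul, Real.norm_eq_abs, mul_comm η] at h1
    exact absurd (le_of_mul_le_mul_left h1 (abs_pos.2 hs)) (not_le.2 hy)
  refine ⟨F, LipschitzWith.of_dist_le_mul fun s t => ?_, ?_, ?_⟩
  · rw [dist_eq_norm, NNReal.coe_one, one_mul]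
    refine (hlip _ (Subtype.coe_prop _) _ (Subtype.coe_prop _)).trans ?_
    simpa [Subtype.dist_eq, Real.dist_eq] using (LipschitzWith.projIcc hℓ).dist_le_mul s t
  · obtain ⟨c, v, -, hcv, -, -⟩ := h.exists_cells_tendsto hε hv ⟨le_rfl, hℓ⟩
    have key : ∀ n, (c n).1 < (c n + v n).1 ∧
        F (c n + v n).1 - F (c n).1 = (v n).2 ∧ (c n + v n).1 - (c n).1 = (v n).1 := fun n => by
      refine ⟨by simpa using h.pos _ (hcv n).2.2.1, ?_, by simp⟩
      rw [hFv _ (hcv n).1, hFv _ (hcv n).2.1]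
      simp
    -- Two slopes at distance at least `ε` cannot both have norm less than `ε / 2`.
    by_contra! hcon
    have h0 := hcon _ _ (key 0).1
    have h1 := hcon _ _ (key 1).1
    rw [(key 0).2.1, (key 0).2.2] at h0
    rw [(key 1).2.1, (key 1).2.2] at h1
    have hp0 := h.pos _ (hcv 0).2.2.1
    have hp1 := h.pos _ (hcv 1).2.2.1
    have h2 := (hcv 0).2.2.2.2.2.trans (norm_sub_le _ _)
    rw [zero_add, norm_smul, Real.norm_of_nonneg (by positivity)] at h2
    have h3 : (v 1).1 / (v 0).1 * ‖(v 0).2‖ ≤ (v 1).1 / (v 0).1 * (ε / 2 * (v 0).1) := by gcongr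
    rw [show (v 1).1 / (v 0).1 * (ε / 2 * (v 0).1) = ε / 2 * (v 1).1 by field_simp] at h3
    linarith
  · intro t η y hη hy hev
    rcases lt_or_ge t 0 with ht | ht0
    · refine hconst t η y hy ?_ hev
      filter_upwards [Iio_mem_nhds ht] with s hs
      simp only [F, Set.projIcc_of_le_left hℓ ht.le, Set.projIcc_of_le_left hℓ (le_of_lt hs)]
    rcases lt_or_ge v₀.1 t with ht | htℓ
    · refine hconst t η y hy ?_ hev
      filter_upwards [Ioi_mem_nhds ht] with s hs
      simp only [F, Set.projIcc_of_right_le hℓ ht.le, Set.projIcc_of_right_le hℓ (le_of_lt hs)]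
    obtain ⟨c, v, z, hcv, hv0, hc⟩ := h.exists_cells_tendsto hε hv ⟨ht0, htℓ⟩
    have hc1 : Tendsto (fun n => (c n).1 - t) atTop (𝓝 0) := by
      simpa using ((continuous_fst.tendsto _).comp hc).sub_const t
    have hc2 : Tendsto (fun n => (c n).1 - t + (v n).1) atTop (𝓝 0) := by
      simpa using hc1.add hv0
    -- Since `t` lies in the cell, the distances from `t` to its two endpoints add up to its length,
    -- so the error constant remains `η`.
    have hslope : ∀ᶠ n in atTop, ‖(v n).2 - (v n).1 • y‖ ≤ η * (v n).1 := by
      filter_upwards [hc1.eventually hev, hc2.eventually hev] with n h1 h2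
      obtain ⟨hm1, hm2, -, hl, hr, -⟩ := hcv n
      rw [show t + ((c n).1 - t) = (c n).1 by ring, hFv _ hm1, abs_of_nonpos (by linarith)] at h1
      rw [show t + ((c n).1 - t + (v n).1) = (c n + v n).1 by simp; ring, hFv _ hm2,
        abs_of_nonneg (by linarith)] at h2
      have h3 : (v n).2 - (v n).1 • y = ((c n + v n).2 - F t - ((c n).1 - t + (v n).1) • y)
          - ((c n).2 - F t - ((c n).1 - t) • y) := by
        rw [Prod.snd_add, add_smul]; abel
      rw [h3]
      refine (norm_sub_le _ _).trans ((add_le_add h2 h1).trans (le_of_eq (by ring)))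
    obtain ⟨n, h0, h1⟩ := (hslope.and ((tendsto_add_atTop_nat 1).eventually hslope)).exists
    have hp0 := h.pos _ (hcv n).2.2.1
    have hp1 := h.pos _ (hcv (n + 1)).2.2.1
    have h2 := (hcv n).2.2.2.2.2
    -- Both consecutive slopes are within `η` of `y`, hence within `2 * η < ε` of each other.
    have h3 : (v (n + 1)).2 - ((v (n + 1)).1 / (v n).1) • (v n).2 =
        ((v (n + 1)).2 - (v (n + 1)).1 • y) -
          ((v (n + 1)).1 / (v n).1) • ((v n).2 - (v n).1 • y) := by
      rw [smul_sub, smul_smul, div_mul_cancel₀ _ hp0.ne']; abel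
    rw [h3] at h2
    have h4 := h2.trans (norm_sub_le _ _)
    rw [norm_smul, Real.norm_of_nonneg (by positivity)] at h4
    have h5 : (v (n + 1)).1 / (v n).1 * ‖(v n).2 - (v n).1 • y‖ ≤
        (v (n + 1)).1 / (v n).1 * (η * (v n).1) := by gcongr
    rw [show (v (n + 1)).1 / (v n).1 * (η * (v n).1) = η * (v (n + 1)).1 by field_simp] at h5
    nlinarith

end IsSplitting

end SlopeSplitting

/-! ### Exhaustion by finitely many disjoint sets -/

section Exhaustion

variable {Ω : Type*} [MeasurableSpace Ω] {ν : Measure Ω} [IsFiniteMeasure ν]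

open scoped ENNReal in
/-- Finite exhaustion: if every nonnull measurable subset of `B` contains a nonnull measurable set
with the property `P`, then `B` is covered, up to arbitrarily small measure, by finitely many
disjoint such sets. -/
theorem exists_finset_disjoint_measure_diff_lt {P : Set Ω → Prop} {B : Set Ω}
    (hB : MeasurableSet B)
    (h : ∀ R ⊆ B, MeasurableSet R → ν R ≠ 0 → ∃ C ⊆ R, MeasurableSet C ∧ ν C ≠ 0 ∧ P C)
    {δ : ℝ≥0∞} (hδ : δ ≠ 0) :
    ∃ t : Finset (Set Ω), (∀ C ∈ t, C ⊆ B ∧ MeasurableSet C ∧ ν C ≠ 0 ∧ P C) ∧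
      (t : Set (Set Ω)).PairwiseDisjoint id ∧ ν (B \ ⋃ C ∈ t, C) < δ := by
  classical
  obtain ⟨F, hF⟩ := zorn_subset
    {F : Set (Set Ω) | (∀ C ∈ F, C ⊆ B ∧ MeasurableSet C ∧ ν C ≠ 0 ∧ P C) ∧
      F.PairwiseDisjoint id} (by
    intro c hc hchain
    refine ⟨⋃₀ c, ⟨?_, ?_⟩, fun s hs => Set.subset_sUnion_of_mem hs⟩
    · rintro C ⟨F, hF, hC⟩
      exact (hc hF).1 C hC
    · exact (Set.pairwiseDisjoint_sUnion hchain.directedOn).2 fun F hF => (hc hF).2)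
  obtain ⟨hFp, hFd⟩ := hF.prop
  have hcount : F.Countable := by
    have := Measure.countable_meas_pos_of_disjoint_of_meas_iUnion_ne_top ν
      (As := fun C : F => (C : Set Ω)) (fun C => (hFp C C.2).2.1)
      (fun C D hCD => hFd C.2 D.2 (fun h => hCD (Subtype.ext h))) (measure_ne_top _ _)
    rw [Set.eq_univ_of_forall (s := {C : F | 0 < ν (C : Set Ω)})
      fun C => pos_iff_ne_zero.2 (hFp C C.2).2.2.1] at this
    exact Set.countable_coe_iff.1 (Set.countable_univ_iff.1 this)
  have hUm : MeasurableSet (⋃ C ∈ F, C) := .biUnion hcount fun C hC => (hFp C hC).2.1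
  -- Otherwise a good set inside the remainder could be added to the maximal family.
  have hnull : ν (B \ ⋃ C ∈ F, C) = 0 := by
    by_contra hne
    obtain ⟨C, hCR, hCm, hC0, hPC⟩ := h _ Set.sdiff_subset (hB.diff hUm) hne
    have hdisj : ∀ D ∈ F, Disjoint C D := fun D hD =>
      Set.disjoint_left.2 fun x hx hxD => (hCR hx).2 (Set.mem_biUnion hD hxD)
    have hins : insert C F ⊆ F := hF.le_of_ge ⟨?_, ?_⟩ (Set.subset_insert _ _)
    · have hself := hdisj C (hins (Set.mem_insert _ _))
      rw [disjoint_self] at hself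
      exact hC0 (by simp [show C = ∅ from hself])
    · rintro D (rfl | hD)
      · exact ⟨hCR.trans Set.sdiff_subset, hCm, hC0, hPC⟩
      · exact hFp D hD
    · exact hFd.insert fun D hD _ => hdisj D hD
  have hsum : ν (⋃ C ∈ F, C) = ∑' C : F, ν C :=
    measure_biUnion hcount hFd fun C hC => (hFp C hC).2.1
  have hlim : Filter.Tendsto (fun t : Finset F => ∑ C ∈ t, ν (C : Set Ω)) Filter.atTop
      (nhds (ν (⋃ C ∈ F, C))) := hsum ▸ ENNReal.summable.hasSum
  have hev : ∀ᶠ t : Finset F in Filter.atTop,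
      ν (⋃ C ∈ F, C) < ∑ C ∈ t, ν (C : Set Ω) + δ := by
    have := hlim.add_const δ
    exact this.eventually_const_lt (ENNReal.lt_add_right (measure_ne_top _ _) hδ)
  obtain ⟨t, ht⟩ := hev.exists
  have htF : ∀ C ∈ t.map (Function.Embedding.subtype _), C ∈ F := by
    intro C hC
    obtain ⟨D, -, rfl⟩ := Finset.mem_map.1 hC
    exact D.2
  refine ⟨t.map (Function.Embedding.subtype _), fun C hC => hFp C (htF C hC),
    hFd.subset htF, ?_⟩
  set T : Set Ω := ⋃ C ∈ t.map (Function.Embedding.subtype _), C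
  have hTm : MeasurableSet T := Finset.measurableSet_biUnion _ fun C hC => (hFp C (htF C hC)).2.1
  have hTsum : ν T = ∑ C ∈ t, ν (C : Set Ω) := by
    rw [measure_biUnion_finset (f := fun C => C) (hFd.subset htF) fun C hC => (hFp C (htF C hC)).2.1,
      Finset.sum_map]
    rfl
  have hTU : T ⊆ ⋃ C ∈ F, C := Set.iUnion₂_subset fun C hC =>
    Set.subset_biUnion_of_mem (u := fun C => C) (htF C hC)
  calc ν (B \ T) ≤ ν ((B \ ⋃ C ∈ F, C) ∪ ((⋃ C ∈ F, C) \ T)) := by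
        refine measure_mono fun x hx => ?_
        by_cases hxU : x ∈ ⋃ C ∈ F, C
        · exact Or.inr ⟨hxU, hx.2⟩
        · exact Or.inl ⟨hx.1, hxU⟩
    _ ≤ 0 + ν ((⋃ C ∈ F, C) \ T) := hnull ▸ measure_union_le _ _
    _ < δ := by
        rw [zero_add, measure_sdiff hTU hTm.nullMeasurableSet (measure_ne_top _ _), hTsum]
        exact ENNReal.sub_lt_of_lt_add
          (hTsum ▸ measure_mono hTU) (by rwa [add_comm] at ht)

end Exhaustion

/-! ### Densities from small oscillation, splittings from large oscillation -/

section Density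

variable {Ω : Type*} [MeasurableSpace Ω] {ν : Measure Ω} [IsFiniteMeasure ν]
  {Y : Type*} [NormedAddCommGroup Y] [NormedSpace ℝ Y] {G : VectorMeasure Ω Y}

omit [IsFiniteMeasure ν] in
open Filter Topology in
/-- A vector measure which is approximated in variation by densities has a density. -/
theorem exists_density_of_variation_approx [CompleteSpace Y]
    (h : ∀ ε : ℝ, 0 < ε → ∃ g : Ω → Y, Integrable g ν ∧
      (G - ν.withDensityᵥ g).variation Set.univ ≤ ENNReal.ofReal ε) :
    ∃ g : Ω → Y, Integrable g ν ∧ ∀ s, MeasurableSet s → G s = ∫ x in s, g x ∂ν := by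
  have hpos : ∀ n : ℕ, (0 : ℝ) < 1 / (n + 1) := fun n => Nat.one_div_pos_of_nat
  choose g hg hgG using fun n : ℕ => h (1 / (n + 1)) (hpos n)
  let u : ℕ → Lp Y 1 ν := fun n => (hg n).toL1 (g n)
  have hdist : ∀ n m, dist (u n) (u m) ≤ 1 / ((n : ℝ) + 1) + 1 / ((m : ℝ) + 1) := by
    intro n m
    -- The variation of a measure with density is the `L¹` norm of the density, so closeness to `G`
    -- in variation makes the densities Cauchy in `L¹`.
    have h1 : ν.withDensityᵥ (g n - g m) =
        (G - ν.withDensityᵥ (g m)) - (G - ν.withDensityᵥ (g n)) := by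
      rw [withDensityᵥ_sub (hg n) (hg m)]; abel
    have h2 : ∫⁻ x, ‖(g n - g m) x‖ₑ ∂ν ≤
        ENNReal.ofReal (1 / ((n : ℝ) + 1) + 1 / ((m : ℝ) + 1)) := by
      rw [← setLIntegral_univ, ← withDensity_apply _ MeasurableSet.univ,
        ← Measure.variation_withDensityᵥ ((hg n).sub (hg m)), h1,
        ENNReal.ofReal_add (hpos n).le (hpos m).le, add_comm]
      exact (VectorMeasure.variation_sub_le _).trans (add_le_add (hgG m) (hgG n))
    rw [dist_eq_norm, ← Integrable.toL1_sub, L1.norm_of_fun_eq_integral_norm,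
      integral_norm_eq_lintegral_enorm ((hg n).sub (hg m)).aestronglyMeasurable]
    exact ENNReal.toReal_le_of_le_ofReal (add_pos (hpos n) (hpos m)).le h2
  have hcau : CauchySeq u := by
    refine cauchySeq_of_le_tendsto_0 (fun N : ℕ => 1 / ((N : ℝ) + 1) + 1 / ((N : ℝ) + 1))
      (fun n m N hn hm => (hdist n m).trans
        (add_le_add (Nat.one_div_le_one_div hn) (Nat.one_div_le_one_div hm))) ?_
    simpa using tendsto_one_div_add_atTop_nhds_zero_nat.add
      (tendsto_one_div_add_atTop_nhds_zero_nat (𝕜 := ℝ))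
  obtain ⟨f, hf⟩ := cauchySeq_tendsto_of_complete hcau
  refine ⟨f, L1.integrable_coeFn f, fun s hs => ?_⟩
  have h1 : Tendsto (fun n => ∫ x in s, g n x ∂ν) atTop (𝓝 (∫ x in s, f x ∂ν)) := by
    refine (((continuous_setIntegral s).tendsto f).comp hf).congr fun n => ?_
    exact setIntegral_congr_ae hs ((hg n).coeFn_toL1.mono fun x hx _ => hx)
  have h2 : Tendsto (fun n => ∫ x in s, g n x ∂ν) atTop (𝓝 (G s)) := by
    rw [tendsto_iff_norm_sub_tendsto_zero]
    refine squeeze_zero (fun _ => norm_nonneg _) (fun n => ?_)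
      (tendsto_one_div_add_atTop_nhds_zero_nat (𝕜 := ℝ))
    have h3 := (VectorMeasure.enorm_measure_le_variation (G - ν.withDensityᵥ (g n)) s).trans
      ((measure_mono (Set.subset_univ s)).trans (hgG n))
    rw [_root_.sub_apply, withDensityᵥ_apply (hg n) hs, ← ofReal_norm] at h3
    rw [norm_sub_rev]
    exact (ENNReal.ofReal_le_ofReal_iff (hpos n).le).1 h3
  exact tendsto_nhds_unique h2 h1

/-- If every nonnull measurable set contains a nonnull measurable set on which the averages of `G`
are within `ε` of each other, then `G` is approximated in variation by a simple density. -/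
theorem exists_variation_sub_withDensity_le [CompleteSpace Y]
    (hG : ∀ s, MeasurableSet s → ‖G s‖ₑ ≤ ν s) {ε : ℝ} (hε : 0 < ε)
    (h : ∀ A, MeasurableSet A → ν A ≠ 0 → ∃ B ⊆ A, MeasurableSet B ∧ ν B ≠ 0 ∧ ∃ a : Y,
      ∀ C ⊆ B, MeasurableSet C → ‖G C - ν.real C • a‖ ≤ ε * ν.real C) :
    ∃ g : Ω → Y, Integrable g ν ∧
      (G - ν.withDensityᵥ g).variation Set.univ ≤ ENNReal.ofReal (ε * (ν.real Set.univ + 1)) := by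
  classical
  obtain ⟨t, ht, htd, htδ⟩ := exists_finset_disjoint_measure_diff_lt (ν := ν)
    (P := fun B => ∃ a : Y, ∀ C ⊆ B, MeasurableSet C → ‖G C - ν.real C • a‖ ≤ ε * ν.real C)
    MeasurableSet.univ (fun R _ hR hR0 => h R hR hR0) (ENNReal.ofReal_pos.2 hε).ne'
  choose! a ha using fun B hB => (ht B hB).2.2.2
  have htm : ∀ B ∈ t, MeasurableSet B := fun B hB => (ht B hB).2.1
  set g : Ω → Y := fun x => ∑ B ∈ t, B.indicator (fun _ => a B) x with hgdef
  have hg : Integrable g ν := integrable_finsetSum _ fun B hB =>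
    (integrable_const (a B)).indicator (htm B hB)
  set R : Set Ω := Set.univ \ ⋃ B ∈ t, B with hRdef
  have hRm : MeasurableSet R := MeasurableSet.univ.diff (Finset.measurableSet_biUnion _ htm)
  have hgB : ∀ B ∈ t, ∀ x ∈ B, g x = a B := fun B hB x hx => by
    rw [hgdef]
    dsimp only
    rw [Finset.sum_eq_single_of_mem B hB, Set.indicator_of_mem hx]
    intro D hD hDB
    exact Set.indicator_of_notMem (fun hxD => Set.disjoint_left.1 (htd hD hB hDB) hxD hx) _
  have hgR : ∀ x ∈ R, g x = 0 := fun x hx => Finset.sum_eq_zero fun B hB =>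
    Set.indicator_of_notMem (fun hxB => hx.2 (Set.mem_biUnion hB hxB)) _
  have hvR : (G - ν.withDensityᵥ g).variation R ≤ ν R := by
    refine VectorMeasure.variation_apply_le_of_forall_enorm_le hRm fun E hE hER => ?_
    rw [_root_.sub_apply, withDensityᵥ_apply hg hE,
      setIntegral_eq_zero_of_forall_eq_zero fun x hx => hgR x (hER hx), sub_zero]
    exact hG E hE
  have hvB : ∀ B ∈ t, (G - ν.withDensityᵥ g).variation B ≤ ENNReal.ofReal ε * ν B := by
    intro B hB
    have : (ENNReal.ofReal ε * ν B) = (ENNReal.ofReal ε • ν) B := by simp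
    rw [this]
    refine VectorMeasure.variation_apply_le_of_forall_enorm_le (htm B hB) fun E hE hEB => ?_
    rw [_root_.sub_apply, withDensityᵥ_apply hg hE,
      setIntegral_congr_fun hE (fun x hx => hgB B hB x (hEB hx)), setIntegral_const,
      Measure.smul_apply, smul_eq_mul, ← ofReal_measureReal (measure_ne_top ν E),
      ← ENNReal.ofReal_mul hε.le, ← ofReal_norm]
    exact ENNReal.ofReal_le_ofReal (ha B hB E hEB hE)
  refine ⟨g, hg, ?_⟩
  calc (G - ν.withDensityᵥ g).variation Set.univ
      ≤ (G - ν.withDensityᵥ g).variation ((⋃ B ∈ t, B) ∪ R) :=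
        measure_mono fun x _ => by
          by_cases hx : x ∈ ⋃ B ∈ t, B
          · exact Or.inl hx
          · exact Or.inr ⟨trivial, hx⟩
    _ ≤ ∑ B ∈ t, (G - ν.withDensityᵥ g).variation B + (G - ν.withDensityᵥ g).variation R :=
        (measure_union_le _ _).trans (add_le_add (measure_biUnion_finset_le _ _) le_rfl)
    _ ≤ ∑ B ∈ t, ENNReal.ofReal ε * ν B + ENNReal.ofReal ε :=
        add_le_add (Finset.sum_le_sum hvB) (hvR.trans htδ.le)
    _ ≤ ENNReal.ofReal ε * ν Set.univ + ENNReal.ofReal ε := by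
        rw [← Finset.mul_sum, ← measure_biUnion_finset (f := fun C => C) htd htm]
        gcongr
        exact Set.subset_univ _
    _ = ENNReal.ofReal (ε * (ν.real Set.univ + 1)) := by
        rw [mul_add, mul_one, ENNReal.ofReal_add (by positivity) hε.le,
          ENNReal.ofReal_mul hε.le, ofReal_measureReal]

/-- If the averages of `G` oscillate by `ε` on every nonnull measurable subset of `A`, then the
pairs `(ν B, G B)`, `B ⊆ A`, can be subdivided. -/
theorem exists_isSplitting (hG : ∀ s, MeasurableSet s → ‖G s‖ ≤ ν.real s) {ε : ℝ}
    (hε : 0 < ε) {A : Set Ω}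
    (h : ∀ B ⊆ A, MeasurableSet B → ν B ≠ 0 → ∀ a : Y,
      ∃ C ⊆ B, MeasurableSet C ∧ ε * ν.real C < ‖G C - ν.real C • a‖) :
    ∃ split, SlopeSplitting.IsSplitting
      {v : ℝ × Y | ∃ B ⊆ A, MeasurableSet B ∧ ν B ≠ 0 ∧ v = (ν.real B, G B)} split ε := by
  classical
  set S := {v : ℝ × Y | ∃ B ⊆ A, MeasurableSet B ∧ ν B ≠ 0 ∧ v = (ν.real B, G B)}
  have hpos : ∀ B : Set Ω, ν B ≠ 0 → 0 < ν.real B := fun B hB =>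
    ENNReal.toReal_pos hB (measure_ne_top _ _)
  have hex : ∀ v ∈ S, ∃ l : List (ℝ × Y), l.sum = v ∧
      ∀ w ∈ l, w ∈ S ∧ ε * w.1 ≤ ‖w.2 - (w.1 / v.1) • v.2‖ := by
    rintro _ ⟨B, hBA, hB, hB0, rfl⟩
    set a : Y := (ν.real B)⁻¹ • G B with ha
    have ha1 : ‖a‖ ≤ 1 := by
      rw [ha, norm_smul, norm_inv, Real.norm_of_nonneg measureReal_nonneg,
        inv_mul_le_one₀ (hpos B hB0)]
      exact hG B hB
    have hslope : ∀ r : ℝ, (r / ν.real B) • G B = r • a := fun r => by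
      rw [ha, smul_smul, div_eq_mul_inv]
    have hne : ∀ C, MeasurableSet C → ε * ν.real C < ‖G C - ν.real C • a‖ → ν C ≠ 0 := by
      intro C hC hlt h0
      have hr : ν.real C = 0 := by simp [Measure.real, h0]
      have := hG C hC
      rw [hr] at hlt this
      simp [norm_le_zero_iff.1 this] at hlt
    obtain ⟨C₀, hC₀B, hC₀, hlt⟩ := h B hBA hB hB0 a
    -- Exhaustion of `B \ C₀` leaves a remainder `R` that need not oscillate, so it is merged with
    -- `C₀`. This costs at most `2 * ν R` in deviation and `ε * ν R` in added length, which the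
    -- slack `γ` pays for once `ν R ≤ γ / (2 + ε)`.
    set γ := ‖G C₀ - ν.real C₀ • a‖ - ε * ν.real C₀ with hγ
    have hγ0 : 0 < γ := sub_pos.2 hlt
    obtain ⟨t, ht, htd, htδ⟩ := exists_finset_disjoint_measure_diff_lt (ν := ν)
      (P := fun C => ε * ν.real C < ‖G C - ν.real C • a‖) (hB.diff hC₀)
      (fun R hR hRm hR0 => by
        obtain ⟨C, hC, hCm, hClt⟩ := h R (hR.trans (Set.sdiff_subset.trans hBA)) hRm hR0 a
        exact ⟨C, hC, hCm, hne C hCm hClt, hClt⟩)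
      (ENNReal.ofReal_pos.2 (div_pos hγ0 (by linarith : 0 < 2 + ε))).ne'
    have htm : ∀ C ∈ t, MeasurableSet C := fun C hC => (ht C hC).2.1
    set T : Set Ω := ⋃ C ∈ t, C
    have hT : MeasurableSet T := Finset.measurableSet_biUnion _ htm
    have hTB : T ⊆ B \ C₀ := Set.iUnion₂_subset fun C hC => (ht C hC).1
    set R : Set Ω := (B \ C₀) \ T with hRdef
    have hR : MeasurableSet R := (hB.diff hC₀).diff hT
    have hRδ : (2 + ε) * ν.real R ≤ γ := by
      have := ENNReal.toReal_le_of_le_ofReal (by positivity) htδ.le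
      rwa [le_div_iff₀ (by linarith), mul_comm] at this
    have hdR : Disjoint C₀ R := Set.disjoint_left.2 fun x hx hxR => hxR.1.2 hx
    have hdT : Disjoint (C₀ ∪ R) T := Set.disjoint_left.2 fun x hx hxT =>
      hx.elim (hTB hxT).2 fun hxR => hxR.2 hxT
    have hBeq : B = (C₀ ∪ R) ∪ T := by
      ext x
      constructor
      · intro hx
        by_cases h1 : x ∈ C₀
        · exact Or.inl (Or.inl h1)
        by_cases h2 : x ∈ T
        · exact Or.inr h2
        · exact Or.inl (Or.inr ⟨⟨hx, h1⟩, h2⟩)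
      · rintro ((hx | hx) | hx)
        · exact hC₀B hx
        · exact hx.1.1
        · exact (hTB hx).1
    have hC₀R : C₀ ∪ R ⊆ B := hBeq ▸ Set.subset_union_left
    refine ⟨(ν.real (C₀ ∪ R), G (C₀ ∪ R)) :: t.toList.map fun C => (ν.real C, G C), ?_, ?_⟩
    · rw [List.sum_cons, Finset.sum_map_toList]
      ext
      · conv_rhs => rw [hBeq]
        rw [measureReal_union hdT hT (measure_ne_top _ _) (measure_ne_top _ _),
          measureReal_biUnion_finset (f := fun C => C) htd htm fun _ _ => measure_ne_top _ _]
        simp [Prod.fst_sum]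
      · conv_rhs => rw [hBeq]
        rw [VectorMeasure.of_union hdT (hC₀.union hR) hT,
          VectorMeasure.of_biUnion_finset (f := fun C => C) htd htm]
        simp [Prod.snd_sum]
    · intro w hw
      rcases List.mem_cons.1 hw with rfl | hw
      · refine ⟨⟨C₀ ∪ R, hC₀R.trans hBA, hC₀.union hR, fun h0 => hne C₀ hC₀ hlt
          (measure_mono_null Set.subset_union_left h0), rfl⟩, ?_⟩
        dsimp only
        rw [hslope, VectorMeasure.of_union hdR hC₀ hR, measureReal_union hdR hR (measure_ne_top _ _) (measure_ne_top _ _)]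
        have h1 : G C₀ - ν.real C₀ • a = (G C₀ + G R - (ν.real C₀ + ν.real R) • a)
            - (G R - ν.real R • a) := by rw [add_smul]; abel
        have h2 : ‖G R - ν.real R • a‖ ≤ 2 * ν.real R := by
          refine (norm_sub_le _ _).trans ?_
          rw [norm_smul, Real.norm_of_nonneg measureReal_nonneg]
          nlinarith [hG R hR, measureReal_nonneg (μ := ν) (s := R)]
        have h3 := norm_sub_le (G C₀ + G R - (ν.real C₀ + ν.real R) • a) (G R - ν.real R • a)
        rw [← h1] at h3
        linarith
      · obtain ⟨C, hC, rfl⟩ := List.mem_map.1 hw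
        obtain ⟨hCB, hCm, hC0, hClt⟩ := ht C (Finset.mem_toList.1 hC)
        exact ⟨⟨C, hCB.trans (Set.sdiff_subset.trans hBA), hCm, hC0, rfl⟩, by
          dsimp only; rw [hslope]; exact hClt.le⟩
  choose! split hs1 hs2 using hex
  refine ⟨split, ?_, ?_, hs1, fun v hv w hw => (hs2 v hv w hw).1,
    fun v hv w hw => (hs2 v hv w hw).2⟩
  · rintro _ ⟨B, -, -, hB0, rfl⟩
    exact hpos B hB0
  · rintro _ ⟨B, -, hB, -, rfl⟩
    exact hG B hB

end Density

/-! ### Approximate derivatives from density -/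

open Filter Topology in
/-- If the maps attaining their norm through a derivative are dense, then every Lipschitz curve has
points of approximate differentiability, with approximate derivatives away from zero. -/
theorem exists_approx_deriv_of_dense {X Y : Type*} [NormedAddCommGroup X] [NormedSpace ℝ X]
    [Nontrivial X] [NormedAddCommGroup Y] [NormedSpace ℝ Y] (hD : Dense (derivAttaining X Y))
    {F : ℝ → Y} (hF : LipschitzWith 1 F) {κ : ℝ} (hκ : 0 < κ)
    (hFκ : ∃ a b, a < b ∧ κ * (b - a) ≤ ‖F b - F a‖) {ε : ℝ} (hε : 0 < ε) :
    ∃ (t η : ℝ) (y : Y), η < ε ∧ η < ‖y‖ ∧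
      ∀ᶠ s in 𝓝 0, ‖F (t + s) - F t - s • y‖ ≤ η * |s| := by
  obtain ⟨u₀, hu₀⟩ := exists_ne (0 : X)
  obtain ⟨φ, hφ, hφu⟩ := exists_dual_vector ℝ u₀ (norm_ne_zero_iff.2 hu₀)
  have hφle : ∀ x, |φ x| ≤ ‖x‖ := fun x => by simpa [hφ] using φ.le_opNorm x
  have hφ1 : LipschitzWith 1 φ := LipschitzWith.of_dist_le_mul fun x y => by
    simpa [dist_eq_norm] using hφle (x - y)
  let f : Lip0 X Y := ⟨fun x => F (φ x) - F 0,
    ⟨1, by simpa using (hF.comp hφ1).sub (LipschitzWith.const (F 0))⟩, by simp⟩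
  have hf : ∀ x, f x = F (φ x) - F 0 := fun _ => rfl
  have hfκ : κ ≤ ‖f‖ := by
    obtain ⟨a, b, hab, hκab⟩ := hFκ
    obtain ⟨w, hw_def⟩ : ∃ w : X, w = ‖u₀‖⁻¹ • u₀ := ⟨_, rfl⟩
    have hw : ‖w‖ = 1 := by
      rw [hw_def, norm_smul, norm_inv, norm_norm, inv_mul_cancel₀ (norm_ne_zero_iff.2 hu₀)]
    have hφw : φ w = 1 := by
      rw [hw_def, map_smul, hφu, smul_eq_mul]
      exact inv_mul_cancel₀ (norm_ne_zero_iff.2 hu₀)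
    have h1 := Lip0.norm_sub_le f (b • w) (a • w)
    rw [hf, hf, ← sub_smul, norm_smul, hw, map_smul, map_smul, hφw, sub_sub_sub_cancel_right,
      Real.norm_of_nonneg (by linarith), mul_one, smul_eq_mul, smul_eq_mul, mul_one, mul_one] at h1
    exact le_of_mul_le_mul_right (hκab.trans h1) (sub_pos.2 hab)
  -- The first bound gives `κ - 3 * δ ≥ κ / 2`, needed for `|r|`, and also `2 * δ < ‖y‖`; the second
  -- gives `2 * δ / |r| ≤ 4 * δ / κ < ε`.
  obtain ⟨δ, hδ0, hδκ, hδε⟩ : ∃ δ : ℝ, 0 < δ ∧ 6 * δ ≤ κ ∧ 4 * δ < ε * κ :=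
    ⟨min (κ / 6) (ε * κ / 5), by positivity, by linarith [min_le_left (κ / 6) (ε * κ / 5)], by
      linarith [min_le_right (κ / 6) (ε * κ / 5), mul_pos hε hκ]⟩
  obtain ⟨g, ⟨x, e, y, he, hgy, hy⟩, hfg⟩ := hD.exists_dist_lt f hδ0
  rw [dist_eq_norm] at hfg
  have hyκ : κ - δ ≤ ‖y‖ := by
    rw [hy]
    linarith [norm_sub_norm_le f g]
  set r := φ e
  -- One `δ` comes from the derivative of `g`, the other from the Lipschitz norm of `f - g`, which
  -- controls difference quotients at every point.
  have hev : ∀ᶠ h in 𝓝 (0 : ℝ), ‖F (φ x + h * r) - F (φ x) - h • y‖ ≤ 2 * δ * |h| := by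
    filter_upwards [(hasLineDerivAt_iff_isLittleO_nhds_zero.1 hgy).def hδ0] with h hh
    rw [Real.norm_eq_abs] at hh
    have h1 : ‖(f - g) (x + h • e) - (f - g) x‖ ≤ δ * |h| := by
      refine (Lip0.norm_sub_le (f - g) _ _).trans ?_
      rw [add_sub_cancel_left, norm_smul, he, mul_one, Real.norm_eq_abs]
      gcongr
    have h2 : F (φ x + h * r) - F (φ x) - h • y =
        ((f - g) (x + h • e) - (f - g) x) + (g (x + h • e) - g x - h • y) := by
      have : ∀ z, (f - g) z = f z - g z := fun _ => rfl
      rw [this, this, hf, hf, map_add, map_smul, smul_eq_mul]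
      abel
    rw [h2]
    linarith [norm_add_le ((f - g) (x + h • e) - (f - g) x) (g (x + h • e) - g x - h • y)]
  -- As `F` is 1-Lipschitz, a derivative of norm near `κ` or more along `e` keeps `e` away from the
  -- kernel of `φ`, so rescaling by `r` is harmless.
  have hrκ : κ / 2 ≤ |r| := by
    obtain ⟨h, h1, h0⟩ := (hev.filter_mono nhdsWithin_le_nhds |>.and
      (self_mem_nhdsWithin (a := (0 : ℝ)) (s := {0}ᶜ))).exists
    have h2 : ‖F (φ x + h * r) - F (φ x)‖ ≤ |h| * |r| := by
      simpa [dist_eq_norm, abs_mul] using hF.dist_le_mul (φ x + h * r) (φ x)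
    have h3 := norm_sub_norm_le (h • y) (F (φ x + h * r) - F (φ x))
    rw [norm_sub_rev (h • y), norm_smul, Real.norm_eq_abs] at h3
    have h4 : |h| * ‖y‖ ≤ |h| * (|r| + 2 * δ) := by linarith
    linarith [le_of_mul_le_mul_left h4 (abs_pos.2 h0)]
  have hr0 : 0 < |r| := by linarith
  have hrne : r ≠ 0 := abs_pos.1 hr0
  refine ⟨φ x, 2 * δ / |r|, r⁻¹ • y, ?_, ?_, ?_⟩
  · rw [div_lt_iff₀ hr0]
    nlinarith
  · rw [norm_smul, norm_inv, Real.norm_eq_abs, div_eq_inv_mul]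
    exact mul_lt_mul_of_pos_left (by linarith) (inv_pos.2 hr0)
  · have : Tendsto (fun s : ℝ => s / r) (𝓝 0) (𝓝 0) := by
      simpa using (continuous_id.div_const r).tendsto 0
    filter_upwards [this.eventually hev] with s hs
    rw [div_mul_cancel₀ _ hrne, abs_div] at hs
    rw [smul_smul, ← div_eq_mul_inv]
    exact hs.trans (le_of_eq (by ring))

/-! ### The Radon–Nikodým property -/

theorem corollary3p3 (X : Type u) [NormedAddCommGroup X] [NormedSpace ℝ X] [CompleteSpace X]
    [Nontrivial X] (Y : Type v) [NormedAddCommGroup Y] [NormedSpace ℝ Y] [CompleteSpace Y]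
    (hD : Dense (derivAttaining X Y)) :
    HasRadonNikodymProperty.{v, w} Y := by
  intro Ω _ μ _ G hfin hac
  -- Relative to its own variation, `G` has averages of norm at most one, as the splitting requires.
  set ν := G.variation with hν
  have : IsFiniteMeasure ν := ⟨hfin⟩
  have hνμ : ν ≪ μ := Measure.AbsolutelyContinuous.mk fun s hs h0 =>
    (VectorMeasure.variation_apply_eq_zero hs).2 fun t hts ht => hac t ht (measure_mono_null hts h0)
  have hloc : ∀ ε : ℝ, 0 < ε → ∀ A, MeasurableSet A → ν A ≠ 0 →
      ∃ B ⊆ A, MeasurableSet B ∧ ν B ≠ 0 ∧ ∃ a : Y,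
        ∀ C ⊆ B, MeasurableSet C → ‖G C - ν.real C • a‖ ≤ ε * ν.real C := by
    intro ε hε A hA hA0
    by_contra! hcon
    obtain ⟨split, hsplit⟩ := exists_isSplitting (ν := ν) (G := G)
      (fun s _ => VectorMeasure.norm_measure_le_variation (measure_ne_top ν s)) hε hcon
    obtain ⟨F, hF, hFκ, hFd⟩ := hsplit.exists_lipschitzWith hε ⟨A, subset_rfl, hA, hA0, rfl⟩
    obtain ⟨t, η, y, hη, hy, hev⟩ :=
      exists_approx_deriv_of_dense hD hF (half_pos hε) hFκ (half_pos hε)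
    exact hFd t η y hη hy hev
  obtain ⟨g, hg, hgG⟩ := exists_density_of_variation_approx (ν := ν) (G := G) fun ε hε => by
    have hpos : 0 < ν.real Set.univ + 1 := by positivity
    obtain ⟨g, hg, hle⟩ := exists_variation_sub_withDensity_le (ν := ν) (G := G)
      (fun s _ => G.enorm_measure_le_variation s) (div_pos hε hpos) (hloc _ (div_pos hε hpos))
    exact ⟨g, hg, by rwa [div_mul_cancel₀ _ hpos.ne'] at hle⟩
  -- The scalar Radon–Nikodým theorem for `ν ≪ μ` turns the density with respect to `ν` into one
  -- with respect to `μ`.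
  exact ⟨fun x => (ν.rnDeriv μ x).toReal • g x, (integrable_rnDeriv_smul_iff hνμ).2 hg,
    fun s hs => by rw [hgG s hs, setIntegral_rnDeriv_smul hνμ hs]⟩
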